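/- Let $\mathfrak A$ be a unital $C^*$-algebra, let $T:\mathfrak A\to\mathfrak A$ be a unital completely positive map and let $\varphi$ be a state on $\mathfrak A$ with $\varphi\circ T=\varphi$ (a state preserving $C^*$-dynamical system). Suppose that $(\mathfrak A,\varphi,T)$ is strictly weak mixing, that is, $$\lim_{n\to\infty}\frac1n\sum_{k=0}^{n-1}\bigl|\psi(T^k(x))-\psi(\mathbf 1)\varphi(x)\bigr|=0\qquad\text{for all }x\in\mathfrak A,\ \psi\in\mathfrak A^*.$$ Let $\{b_n\}_{n\ge0}\subset\mathbb C$ be an $S$-Besicovitch sequence, that is, a bounded sequence such that for every $\epsilon>0$ there are a compact Hausdorff space $K$, a state preserving $C^*$-dynamical system $(C(K),\nu,T_1)$ that is uniquely ergodic ($\nu$ is the only $T_1$-invariant state on $C(K)$), a function $f_0\in C(K)$ and a point $\omega_0\in K$ with $$\limsup_{n\to\infty}\frac1n\sum_{k=0}^{n-1}\bigl|b_k-(T_1^kf_0)(\omega_0)\bigr|<\epsilon.$$ Then for every $x\in\mathfrak A$ the weighted averages $$\frac1n\sum_{k=0}^{n-1}b_kT^k(x)$$ converge in the norm of $\mathfrak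 A$ as $n\to\infty$. -/

import Mathlib

open Filter Topology
open scoped ComplexOrder CStarAlgebra

universe u v

noncomputable section

namespace CStarDynamics

section General

variable {A : Type*} [CStarAlgebra A] [PartialOrder A] [StarOrderedRing A]

/-- A state on a unital `C*`-algebra: a positive functional in the dual that takes the value `1`
at the unit. -/
structure IsState (φ : StrongDual ℂ A) : Prop where
  nonneg : ∀ x : A, 0 ≤ φ (star x * x)
  map_one : φ 1 = 1

/-- `φ` is invariant under `T`, that is, `φ ∘ T = φ`. -/
def IsInvariant (φ : StrongDual ℂ A) (T : A →CP A) : Prop :=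
  ∀ x : A, φ (T x) = φ x

/-- `(A, φ, T)` is a state preserving `C*`-dynamical system: `T` is a unital completely positive
map of `A` and `φ` is a `T`-invariant state. -/
structure IsStatePreserving (φ : StrongDual ℂ A) (T : A →CP A) : Prop where
  map_one : T 1 = 1
  isState : IsState φ
  invariant : IsInvariant φ T

/-- The state preserving system `(A, φ, T)` is strictly weak mixing. -/
structure IsStrictlyWeakMixing (φ : StrongDual ℂ A) (T : A →CP A) : Prop
    extends IsStatePreserving φ T where
  mixing : ∀ (x : A) (ψ : StrongDual ℂ A),
    Tendsto (fun n : ℕ => (n : ℝ)⁻¹ * ∑ k ∈ Finset.range n, ‖ψ ((⇑T)^[k] x) - ψ 1 * φ x‖)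
      atTop (𝓝 0)

/-- The state preserving system `(A, φ, T)` is uniquely ergodic: `φ` is the only `T`-invariant
state. -/
structure IsUniquelyErgodic (φ : StrongDual ℂ A) (T : A →CP A) : Prop
    extends IsStatePreserving φ T where
  unique : ∀ ψ : StrongDual ℂ A, IsState ψ → IsInvariant ψ T → ψ = φ

end General

/-- `S`-Besicovitch sequences: bounded complex sequences that, for every `ε > 0`, are within `ε` in
upper mean of a sequence `(T₁ ^ k f₀) (ω₀)` produced by a uniquely ergodic system
`(C(K), ν, T₁)`, with `K` compact Hausdorff, `f₀` in `C(K)` and `ω₀` in `K`.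
The averages below are bounded, so that the real `limsup` is the usual one. -/
structure IsSBesicovitch (b : ℕ → ℂ) : Prop where
  bounded : ∃ C : ℝ, ∀ k, ‖b k‖ ≤ C
  approx : ∀ ε : ℝ, 0 < ε →
    ∃ (K : Type v) (_ : TopologicalSpace K) (_ : CompactSpace K) (_ : T2Space K)
      (ν : StrongDual ℂ C(K, ℂ)) (T₁ : C(K, ℂ) →CP C(K, ℂ)) (f₀ : C(K, ℂ)) (ω₀ : K),
      IsUniquelyErgodic ν T₁ ∧
      limsup (fun n : ℕ =>
        (n : ℝ)⁻¹ * ∑ k ∈ Finset.range n, ‖b k - ((⇑T₁)^[k] f₀) ω₀‖) atTop < ε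

end CStarDynamics

end

namespace CStarDynamics

open Finset MeasureTheory

/-! ### Uniform bounds for iterates of unital positive maps. -/

section PowerBounded

variable {A : Type*} [CStarAlgebra A] [PartialOrder A] [StarOrderedRing A]

/-! Since `T` fixes `1`, splitting `x = φ x • 1 + (x - φ x • 1)` leaves two limits. The scalar part
needs only that `b` has a mean: unique ergodicity makes the means of the approximating sequences
converge, so those of `b` are Cauchy. For the centred part, norm convergence follows once mixing to
zero is uniform over the dual unit ball. The dual map acts on a weak-* compact set of functionals,
where `|ψ x|` is continuous with ergodic averages tending to zero pointwise
(`eventually_average_norm_lt`). If this were not uniform, averages at bad points would produce an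
invariant positive functional with nonzero value on that function, against dominated convergence
(`tendstoUniformly_average`). -/

lemma norm_apply_le_of_positive (f : A →ₚ[ℂ] A) (a : A) : ‖f a‖ ≤ 4 * ‖f 1‖ * ‖a‖ := by
  -- The factor 4 counts the positive pieces of `a`. It is not sharp, but it does not depend on `f`.
  obtain ⟨y, hy_nonneg, hy_norm, hy⟩ := CStarAlgebra.exists_sum_four_nonneg a
  conv_lhs => rw [hy]
  simp only [map_sum, map_smul]
  refine (norm_sum_le _ _).trans ?_
  simp only [norm_smul, norm_pow, Complex.norm_I, one_pow, one_mul]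
  refine (Finset.sum_le_sum (g := fun _ ↦ ‖f 1‖ * ‖a‖) fun i _ ↦ ?_).trans <| by
    simp [mul_assoc]
  exact (f.norm_apply_le_of_nonneg _ (hy_nonneg i)).trans (by gcongr; exact hy_norm i)

/-- The iterates of a unital completely positive map are uniformly bounded. -/
lemma norm_iterate_apply_le {T : A →CP A} (hT : T 1 = 1) (k : ℕ) (a : A) :
    ‖(⇑T)^[k] a‖ ≤ 4 * ‖(1 : A)‖ * ‖a‖ := by
  obtain ⟨f, hf⟩ : ∃ f : A →ₚ[ℂ] A, ⇑f = (⇑T)^[k] := by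
    induction k with
    | zero => exact ⟨.id ℂ A, rfl⟩
    | succ k ih =>
      obtain ⟨f, hf⟩ := ih
      exact ⟨f.comp (.ofClass T), by rw [Function.iterate_succ, ← hf]; rfl⟩
  simpa [← hf, show f 1 = 1 by rw [hf, Function.iterate_fixed hT]]
    using norm_apply_le_of_positive f a

/-- A completely positive map as a continuous linear map. -/
def toCLM (T : A →CP A) : A →L[ℂ] A := ⟨T.toLinearMap, map_continuous T⟩

lemma toCLM_pow_apply (T : A →CP A) (k : ℕ) (a : A) : (toCLM T ^ k) a = (⇑T)^[k] a := by
  induction k generalizing a with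
  | zero => rfl
  | succ k ih => rw [pow_succ, Function.iterate_succ_apply, ← ih]; rfl

end PowerBounded

/-! ### Krylov–Bogolyubov averaging along an ultrafilter. -/

section InvariantFunctional

variable {𝕜 E : Type*} [RCLike 𝕜] [NormedAddCommGroup E] [NormedSpace 𝕜 E]

/-- Limits along an ultrafilter of functionals averaged along the powers of a power bounded
operator define invariant functionals. -/
lemma exists_invariant_functional (S : E →L[𝕜] E) {C : ℝ} (hS : ∀ k x, ‖(S ^ k) x‖ ≤ C * ‖x‖)
    (ψ : ℕ → StrongDual 𝕜 E) (hψ : ∀ n, ‖ψ n‖ ≤ 1) (U : Ultrafilter ℕ) (hU : (U : Filter ℕ) ≤ atTop) :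
    ∃ m : StrongDual 𝕜 E, (∀ x, m (S x) = m x) ∧
      ∀ x, Tendsto (fun n : ℕ ↦ (n : 𝕜)⁻¹ * ∑ k ∈ range n, ψ n ((S ^ k) x)) U (𝓝 (m x)) := by
  have hψS (n k : ℕ) (x : E) : ‖ψ n ((S ^ k) x)‖ ≤ C * ‖x‖ :=
    ((ψ n).le_of_opNorm_le (hψ n) _).trans (by simpa using hS k x)
  have hC (x : E) : 0 ≤ C * ‖x‖ := (norm_nonneg _).trans (hψS 0 0 x)
  let Λ (n : ℕ) : E →ₗ[𝕜] 𝕜 := (n : 𝕜)⁻¹ • ∑ k ∈ range n, ((ψ n).comp (S ^ k)).toLinearMap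
  have hΛ (n : ℕ) (x : E) : Λ n x = (n : 𝕜)⁻¹ * ∑ k ∈ range n, ψ n ((S ^ k) x) := by
    simp only [Λ, LinearMap.smul_apply, LinearMap.sum_apply, smul_eq_mul]
    rfl
  have hΛ_norm (n : ℕ) (x : E) : ‖Λ n x‖ ≤ C * ‖x‖ := by
    rw [hΛ, norm_mul, norm_inv, RCLike.norm_natCast]
    rcases n.eq_zero_or_pos with rfl | hn
    · simpa using hC x
    rw [inv_mul_le_iff₀ (by positivity)]
    exact (norm_sum_le_of_le _ fun k _ ↦ hψS n k x).trans (by simp)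
  have hlim (x : E) : ∃ y, Tendsto (fun n ↦ Λ n x) U (𝓝 y) := by
    obtain ⟨y, -, hy⟩ := (isCompact_closedBall (0 : 𝕜) (C * ‖x‖)).ultrafilter_le_nhds
      (U.map fun n ↦ Λ n x) (by
        simp only [le_principal_iff, Ultrafilter.mem_coe, Ultrafilter.mem_map]
        exact Filter.univ_mem' fun n ↦ by simpa using hΛ_norm n x)
    exact ⟨y, hy⟩
  choose m hm using hlim
  let M : E →ₗ[𝕜] 𝕜 :=
    { toFun := m
      map_add' x y := tendsto_nhds_unique (hm (x + y))
        (((hm x).add (hm y)).congr fun n ↦ (map_add _ _ _).symm)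
      map_smul' c x := tendsto_nhds_unique (hm (c • x))
        (((hm x).const_smul c).congr fun n ↦ (map_smul _ _ _).symm) }
  refine ⟨M.mkContinuous C fun x ↦ le_of_tendsto (hm x).norm (.of_forall (hΛ_norm · x)), ?_, ?_⟩
  · intro x
    refine tendsto_nhds_unique (hm (S x)) ?_
    -- The difference telescopes to two boundary terms divided by `n`.
    have h0 : Tendsto (fun n : ℕ ↦ Λ n (S x) - Λ n x) U (𝓝 0) := by
      have hN : Tendsto (fun n : ℕ ↦ (n : ℝ)⁻¹ * (2 * (C * ‖x‖))) U (𝓝 0) := by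
        simpa using (tendsto_inv_atTop_nhds_zero_nat (𝕜 := ℝ)).mul_const
          (2 * (C * ‖x‖)) |>.mono_left hU
      refine squeeze_zero_norm (fun n ↦ ?_) hN
      have : Λ n (S x) - Λ n x = (n : 𝕜)⁻¹ * (ψ n ((S ^ n) x) - ψ n ((S ^ 0) x)) := by
        rw [hΛ, hΛ, ← mul_sub, ← Finset.sum_sub_distrib,
          ← Finset.sum_range_sub (fun k ↦ ψ n ((S ^ k) x))]
        simp [pow_succ]
      rw [this, norm_mul, norm_inv, RCLike.norm_natCast, two_mul]
      gcongr
      exact (norm_sub_le _ _).trans (add_le_add (hψS n n x) (hψS n 0 x))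
    have h1 := (h0.add (hm x)).congr fun n ↦ sub_add_cancel _ _
    rwa [zero_add] at h1
  · exact fun x ↦ (hm x).congr fun n ↦ hΛ n x

end InvariantFunctional

/-! ### Unique ergodicity and means of the weights. -/

section UniquelyErgodic

variable {K : Type*} [TopologicalSpace K] [CompactSpace K]

/-- In a uniquely ergodic system on `C(K)`, the ergodic averages converge pointwise. -/
lemma IsUniquelyErgodic.tendsto_average {ν : StrongDual ℂ C(K, ℂ)} {T : C(K, ℂ) →CP C(K, ℂ)}
    (h : IsUniquelyErgodic ν T) (f : C(K, ℂ)) (ω : K) :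
    Tendsto (fun n : ℕ ↦ (n : ℂ)⁻¹ * ∑ k ∈ range n, ((⇑T)^[k] f) ω) atTop (𝓝 (ν f)) := by
  -- Every ultrafilter limit of the averages is an invariant state, hence `ν`.
  rw [tendsto_iff_ultrafilter]
  intro U hU
  let ev : StrongDual ℂ C(K, ℂ) := ContinuousMap.evalCLM ℂ ω
  have hev : ‖ev‖ ≤ 1 := ContinuousLinearMap.opNorm_le_bound _ zero_le_one fun g ↦ by
    simpa [ev] using g.norm_coe_le_norm ω
  obtain ⟨m, hm, hlim⟩ := exists_invariant_functional (toCLM T)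
    (fun k x ↦ by rw [toCLM_pow_apply]; exact norm_iterate_apply_le h.map_one k x)
    (fun _ ↦ ev) (fun _ ↦ hev) U hU
  simp only [toCLM_pow_apply] at hlim
  suffices IsState m by
    rw [← h.unique m this hm]
    exact hlim f
  constructor
  · intro g
    refine ge_of_tendsto (hlim _) (.of_forall fun n ↦ ?_)
    refine mul_nonneg (by positivity) (Finset.sum_nonneg fun k _ ↦ ?_)
    have hk : 0 ≤ (⇑T)^[k] (star g * g) := by
      clear * -
      induction k with
      | zero => exact star_mul_self_nonneg g
      | succ k ih => rw [Function.iterate_succ_apply']; exact map_nonneg T ih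
    exact ContinuousMap.le_def.1 hk ω
  · refine tendsto_nhds_unique (hlim 1) (tendsto_const_nhds.congr' ?_)
    filter_upwards [hU (eventually_gt_atTop 0)] with n hn
    have hn' : (n : ℂ) ≠ 0 := by exact_mod_cast hn.ne'
    simp [Function.iterate_fixed h.map_one, ev, hn']

end UniquelyErgodic

/-- The averages of an `S`-Besicovitch sequence converge. -/
lemma IsSBesicovitch.exists_tendsto_average {b : ℕ → ℂ} (hb : IsSBesicovitch.{v} b) :
    ∃ L : ℂ, Tendsto (fun n : ℕ ↦ (n : ℂ)⁻¹ * ∑ k ∈ range n, b k) atTop (𝓝 L) := by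
  refine cauchySeq_tendsto_of_complete (Metric.cauchySeq_iff'.2 fun ε hε ↦ ?_)
  obtain ⟨K, _, _, _, ν, T, f, ω, hν, hlim⟩ := hb.approx (ε / 4) (by positivity)
  obtain ⟨C, hC⟩ := hb.bounded
  set c : ℕ → ℂ := fun k ↦ ((⇑T)^[k] f) ω with hc
  obtain ⟨D, hD⟩ : ∃ D, ∀ k, ‖c k‖ ≤ D :=
    ⟨_, fun k ↦ (ContinuousMap.norm_coe_le_norm _ ω).trans (norm_iterate_apply_le hν.map_one k f)⟩
  -- A real `limsup` controls eventual values only for a sequence bounded above.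
  have hbdd (n : ℕ) : (n : ℝ)⁻¹ * ∑ k ∈ range n, ‖b k - c k‖ ≤ C + D := by
    have h0 : 0 ≤ C + D := add_nonneg ((norm_nonneg _).trans (hC 0)) ((norm_nonneg _).trans (hD 0))
    rcases n.eq_zero_or_pos with rfl | hn
    · simpa using h0
    rw [inv_mul_le_iff₀ (by positivity)]
    calc ∑ k ∈ range n, ‖b k - c k‖ ≤ ∑ k ∈ range n, (C + D) :=
          Finset.sum_le_sum fun k _ ↦ (norm_sub_le _ _).trans (add_le_add (hC k) (hD k))
      _ = n * (C + D) := by rw [Finset.sum_const, Finset.card_range, nsmul_eq_mul]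
  have h1 := eventually_lt_of_limsup_lt hlim (isBoundedUnder_of ⟨_, hbdd⟩)
  have h2 := Metric.tendsto_nhds.1 (hν.tendsto_average f ω) (ε / 4) (by positivity)
  obtain ⟨N, hN⟩ := eventually_atTop.1 (h1.and h2)
  have key (n : ℕ) (hn : N ≤ n) : dist ((n : ℂ)⁻¹ * ∑ k ∈ range n, b k) (ν f) < ε / 2 := by
    have h3 : dist ((n : ℂ)⁻¹ * ∑ k ∈ range n, b k) ((n : ℂ)⁻¹ * ∑ k ∈ range n, c k) ≤
        (n : ℝ)⁻¹ * ∑ k ∈ range n, ‖b k - c k‖ := by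
      rw [dist_eq_norm, ← mul_sub, ← Finset.sum_sub_distrib, norm_mul, norm_inv,
        Complex.norm_natCast]
      gcongr
      exact norm_sum_le _ _
    linarith [dist_triangle ((n : ℂ)⁻¹ * ∑ k ∈ range n, b k) ((n : ℂ)⁻¹ * ∑ k ∈ range n, c k)
      (ν f), hN n hn]
  refine ⟨N, fun n hn ↦ ?_⟩
  linarith [dist_triangle_right ((n : ℂ)⁻¹ * ∑ k ∈ range n, b k)
    ((N : ℂ)⁻¹ * ∑ k ∈ range N, b k) (ν f), key n hn, key N le_rfl]

/-! ### From pointwise to uniform convergence of ergodic averages. -/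

section Uniform

variable {B : Type*} [TopologicalSpace B] [CompactSpace B] [T2Space B]

/-- A positive functional on `C(B, ℝ)` is continuous for bounded pointwise convergence. -/
lemma tendsto_of_positive_functional (m : C(B, ℝ) →ₗ[ℝ] ℝ) (hm : ∀ g, 0 ≤ g → 0 ≤ m g)
    {F : ℕ → C(B, ℝ)} {C : ℝ} (hC : ∀ n, ‖F n‖ ≤ C)
    (hF : ∀ ω, Tendsto (fun n ↦ F n ω) atTop (𝓝 0)) :
    Tendsto (fun n ↦ m (F n)) atTop (𝓝 0) := by
  let _ : MeasurableSpace B := borel B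
  have : BorelSpace B := ⟨rfl⟩
  let Λ : CompactlySupportedContinuousMap B ℝ →ₚ[ℝ] ℝ :=
    { toFun g := m g.toContinuousMap
      map_add' g g' := map_add m _ _
      map_smul' c g := map_smul m _ _
      monotone' g g' h := by
        have := hm (g'.toContinuousMap - g.toContinuousMap) (fun ω ↦ sub_nonneg.2 (h ω))
        rw [map_sub] at this
        exact sub_nonneg.1 this }
  have hint (g : C(B, ℝ)) : m g = ∫ ω, g ω ∂(RealRMK.rieszMeasure Λ) :=
    (RealRMK.integral_rieszMeasure Λ ⟨g, .of_compactSpace _⟩).symm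
  simp only [hint]
  rw [← integral_zero B ℝ (μ := RealRMK.rieszMeasure Λ)]
  refine tendsto_integral_of_dominated_convergence (fun _ ↦ C) ?_ (integrable_const C) ?_ ?_
  · exact fun n ↦ (F n).continuous.measurable.aestronglyMeasurable
  · exact fun n ↦ .of_forall fun ω ↦ ((F n).norm_coe_le_norm ω).trans (hC n)
  · exact .of_forall hF

/-- If the ergodic averages of a continuous function on a compact space tend to zero pointwise,
they do so uniformly. -/
lemma tendstoUniformly_average (σ : C(B, B)) (f : C(B, ℝ))
    (hf : ∀ ω, Tendsto (fun n : ℕ ↦ (n : ℝ)⁻¹ * ∑ k ∈ range n, f (σ^[k] ω)) atTop (𝓝 0)) :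
    TendstoUniformly (fun (n : ℕ) ω ↦ (n : ℝ)⁻¹ * ∑ k ∈ range n, f (σ^[k] ω)) 0 atTop := by
  rw [Metric.tendstoUniformly_iff]
  by_contra! hcon
  obtain ⟨ε, hε, hfreq⟩ := hcon
  simp only [Pi.zero_apply, dist_zero_left] at hfreq
  obtain ⟨ω₀⟩ : Nonempty B := hfreq.exists.elim fun _ h ↦ ⟨h.choose⟩
  have := frequently_iff_neBot.1 hfreq
  -- `U` concentrates on the bad indices, so the averages at the bad points `ω n` stay at least `ε`
  -- in norm along it.
  obtain ⟨U, hUle⟩ := Ultrafilter.exists_le (atTop ⊓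
    𝓟 {n : ℕ | ∃ ω, ε ≤ ‖(n : ℝ)⁻¹ * ∑ k ∈ range n, f (σ^[k] ω)‖})
  have hU : (U : Filter ℕ) ≤ atTop := hUle.trans inf_le_left
  have hUε := hUle.trans inf_le_right (mem_principal_self _)
  have hex (n : ℕ) : ∃ ω, (∃ ω', ε ≤ ‖(n : ℝ)⁻¹ * ∑ k ∈ range n, f (σ^[k] ω')‖) →
      ε ≤ ‖(n : ℝ)⁻¹ * ∑ k ∈ range n, f (σ^[k] ω)‖ := by
    by_cases h : ∃ ω', ε ≤ ‖(n : ℝ)⁻¹ * ∑ k ∈ range n, f (σ^[k] ω')‖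
    · exact h.imp fun _ hω _ ↦ hω
    · exact ⟨ω₀, fun h' ↦ absurd h' h⟩
  choose ω hω using hex
  let S : C(B, ℝ) →L[ℝ] C(B, ℝ) :=
    { toFun g := g.comp σ
      map_add' _ _ := rfl
      map_smul' _ _ := rfl
      cont := ContinuousMap.continuous_precomp σ }
  have hS (k : ℕ) (g : C(B, ℝ)) (x : B) : (S ^ k) g x = g (σ^[k] x) := by
    induction k generalizing x with
    | zero => rfl
    | succ k ih => rw [pow_succ', Function.iterate_succ_apply, ← ih]; rfl
  have hSnorm (k : ℕ) (g : C(B, ℝ)) : ‖(S ^ k) g‖ ≤ 1 * ‖g‖ := by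
    rw [one_mul, ContinuousMap.norm_le _ (norm_nonneg _)]
    exact fun x ↦ by rw [hS]; exact g.norm_coe_le_norm _
  obtain ⟨m, hm, hlim⟩ := exists_invariant_functional S hSnorm
    (fun n ↦ ContinuousMap.evalCLM ℝ (ω n))
    (fun n ↦ ContinuousLinearMap.opNorm_le_bound _ zero_le_one fun g ↦ by
      simpa using g.norm_coe_le_norm (ω n)) U hU
  have hlim' (g : C(B, ℝ)) :
      Tendsto (fun n : ℕ ↦ (n : ℝ)⁻¹ * ∑ k ∈ range n, g (σ^[k] (ω n))) U (𝓝 (m g)) := by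
    simpa only [ContinuousMap.evalCLM_apply, hS] using! hlim g
  have hmk (k : ℕ) (g : C(B, ℝ)) : m ((S ^ k) g) = m g := by
    induction k with
    | zero => rfl
    | succ k ih => rw [pow_succ', ← ih]; exact hm _
  -- Invariance gives `m (F n) = m f` for `n > 0`, while `F n` tends to zero boundedly and
  -- pointwise; hence `m f = 0`.
  let F (n : ℕ) : C(B, ℝ) := (n : ℝ)⁻¹ • ∑ k ∈ range n, (S ^ k) f
  have hF0 : Tendsto (fun n ↦ m (F n)) atTop (𝓝 0) := by
    refine tendsto_of_positive_functional m.toLinearMap (C := ‖f‖) (fun g hg ↦ ?_) (fun n ↦ ?_)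
      fun x ↦ ?_
    · exact ge_of_tendsto (hlim' g) (.of_forall fun n ↦
        mul_nonneg (by positivity) (Finset.sum_nonneg fun k _ ↦ hg _))
    · rcases n.eq_zero_or_pos with rfl | hn
      · simp [F]
      rw [norm_smul, norm_inv, RCLike.norm_natCast, inv_mul_le_iff₀ (by positivity)]
      exact (norm_sum_le_of_le _ fun k _ ↦ hSnorm k f).trans (by simp)
    · refine (hf x).congr fun n ↦ ?_
      simp only [F, ContinuousMap.smul_apply, ContinuousMap.sum_apply, hS, smul_eq_mul]
  have hmf : m f = 0 := by
    refine tendsto_nhds_unique (tendsto_const_nhds.congr' ?_) hF0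
    filter_upwards [eventually_gt_atTop 0] with n hn
    have hn' : (n : ℝ) ≠ 0 := by positivity
    simp only [F, map_smul, map_sum, hmk, sum_const, card_range, nsmul_eq_mul, smul_eq_mul]
    rw [inv_mul_cancel_left₀ hn']
  have : ε ≤ ‖m f‖ := ge_of_tendsto (hlim' f).norm (Filter.mem_of_superset hUε hω)
  simp [hmf] at this
  linarith

end Uniform

/-! ### Uniform mixing over the dual ball. -/

section DualDynamics

variable {X : Type*} [NormedAddCommGroup X] [NormedSpace ℂ X]

/-- If the orbit of `x` under a power bounded operator is weakly mixing to zero, then it is so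
uniformly on the unit ball of the dual. -/
lemma eventually_average_norm_lt (S : X →L[ℂ] X) {C : ℝ} (hS : ∀ k x, ‖(S ^ k) x‖ ≤ C * ‖x‖)
    (x : X) (hx : ∀ ψ : StrongDual ℂ X,
      Tendsto (fun n : ℕ ↦ (n : ℝ)⁻¹ * ∑ k ∈ range n, ‖ψ ((S ^ k) x)‖) atTop (𝓝 0))
    {ε : ℝ} (hε : 0 < ε) :
    ∀ᶠ n : ℕ in atTop, ∀ ψ : StrongDual ℂ X, ‖ψ‖ ≤ 1 →
      (n : ℝ)⁻¹ * ∑ k ∈ range n, ‖ψ ((S ^ k) x)‖ < ε := by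
  -- The unit ball need not be invariant under the adjoint of `S`. Bounding the whole orbit makes
  -- `B` invariant, and `B` still contains the unit ball.
  let B : Set (WeakDual ℂ X) := {ψ | ∀ (k : ℕ) (y : X), ‖ψ ((S ^ k) y)‖ ≤ C * ‖y‖}
  have hBclosed : IsClosed B := by
    simp only [B, Set.ofPred_forall]
    exact isClosed_iInter fun k ↦ isClosed_iInter fun y ↦
      isClosed_le (WeakDual.eval_continuous _).norm continuous_const
  have hBcompact : IsCompact B := by
    refine (WeakDual.isCompact_closedBall (𝕜 := ℂ) (E := X) 0 |C|).of_isClosed_subset hBclosed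
      fun ψ hψ ↦ ?_
    simp only [Set.mem_preimage, mem_closedBall_zero_iff]
    refine ContinuousLinearMap.opNorm_le_bound _ (abs_nonneg C) fun y ↦ (hψ 0 y).trans ?_
    gcongr
    exact le_abs_self C
  have : CompactSpace B := isCompact_iff_compactSpace.1 hBcompact
  let σ₀ (ψ : WeakDual ℂ X) : WeakDual ℂ X :=
    StrongDual.toWeakDual ((WeakDual.toStrongDual ψ).comp S)
  have hσ₀ : Continuous σ₀ := WeakDual.continuous_of_continuous_eval fun y ↦
    WeakDual.eval_continuous (S y)
  let σ : C(B, B) :=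
    ⟨fun ψ ↦ ⟨σ₀ ψ, fun k y ↦ by
      have := ψ.2 (k + 1) y
      rwa [pow_succ'] at this⟩, (hσ₀.comp continuous_subtype_val).subtype_mk _⟩
  let f : C(B, ℝ) :=
    ⟨fun ψ ↦ ‖ψ.1 x‖, ((WeakDual.eval_continuous x).comp continuous_subtype_val).norm⟩
  have hf (k : ℕ) (ψ : B) : f (σ^[k] ψ) = ‖ψ.1 ((S ^ k) x)‖ := by
    suffices ∀ y, (σ^[k] ψ).1 y = ψ.1 ((S ^ k) y) from congrArg norm (this x)
    induction k with
    | zero => exact fun _ ↦ rfl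
    | succ k ih =>
      intro y
      rw [Function.iterate_succ_apply', pow_succ]
      exact ih (S y)
  have hunif := tendstoUniformly_average σ f fun ψ ↦ by
    simp only [hf]
    exact hx (WeakDual.toStrongDual ψ.1)
  rw [Metric.tendstoUniformly_iff] at hunif
  filter_upwards [hunif ε hε] with n hn ψ hψ
  have hψB : StrongDual.toWeakDual ψ ∈ B := fun k y ↦
    (ψ.le_of_opNorm_le hψ _).trans (by simpa using hS k y)
  have h := hn ⟨_, hψB⟩
  simp only [hf, Pi.zero_apply, dist_zero_left] at h
  exact (le_abs_self _).trans_lt h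

/-- Weighted averages with bounded weights of a weakly mixing orbit tend to zero in norm. -/
lemma tendsto_weighted_average_zero (S : X →L[ℂ] X) {C : ℝ}
    (hS : ∀ k x, ‖(S ^ k) x‖ ≤ C * ‖x‖) (x : X)
    (hx : ∀ ψ : StrongDual ℂ X,
      Tendsto (fun n : ℕ ↦ (n : ℝ)⁻¹ * ∑ k ∈ range n, ‖ψ ((S ^ k) x)‖) atTop (𝓝 0))
    {b : ℕ → ℂ} {D : ℝ} (hb : ∀ k, ‖b k‖ ≤ D) :
    Tendsto (fun n : ℕ ↦ (n : ℂ)⁻¹ • ∑ k ∈ range n, b k • (S ^ k) x) atTop (𝓝 0) := by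
  have hD : 0 ≤ D := (norm_nonneg _).trans (hb 0)
  rw [Metric.tendsto_nhds]
  intro ε hε
  -- `D + 1` keeps the denominator positive when `D = 0` and makes the final inequality strict.
  filter_upwards [eventually_average_norm_lt S hS x hx (ε := ε / (D + 1)) (by positivity)]
    with n hn
  -- A norming functional chosen for each `n`; this is where uniformity in `ψ` is needed.
  obtain ⟨ψ, hψ, hψn⟩ := exists_dual_vector'' ℂ ((n : ℂ)⁻¹ • ∑ k ∈ range n, b k • (S ^ k) x)
  have hnorm : ‖(n : ℂ)⁻¹ • ∑ k ∈ range n, b k • (S ^ k) x‖ =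
      ‖ψ ((n : ℂ)⁻¹ • ∑ k ∈ range n, b k • (S ^ k) x)‖ := by
    rw [hψn]; simp
  rw [dist_zero_right, hnorm]
  calc ‖ψ ((n : ℂ)⁻¹ • ∑ k ∈ range n, b k • (S ^ k) x)‖
      = (n : ℝ)⁻¹ * ‖∑ k ∈ range n, b k * ψ ((S ^ k) x)‖ := by simp
    _ ≤ (n : ℝ)⁻¹ * ∑ k ∈ range n, D * ‖ψ ((S ^ k) x)‖ := by
        gcongr
        refine norm_sum_le_of_le _ fun k _ ↦ ?_
        rw [norm_mul]
        gcongr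
        exact hb k
    _ = D * ((n : ℝ)⁻¹ * ∑ k ∈ range n, ‖ψ ((S ^ k) x)‖) := by rw [← Finset.mul_sum]; ring
    _ ≤ D * (ε / (D + 1)) := by gcongr; exact (hn ψ hψ).le
    _ < ε := by rw [mul_div_assoc', div_lt_iff₀ (by positivity)]; linarith

end DualDynamics

end CStarDynamics

theorem mainTheorem4 {A : Type u} [CStarAlgebra A] [PartialOrder A] [StarOrderedRing A]
    (φ : StrongDual ℂ A) (T : A →CP A) (hT : CStarDynamics.IsStrictlyWeakMixing φ T)
    (b : ℕ → ℂ) (hb : CStarDynamics.IsSBesicovitch.{v} b) (x : A) :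
    ∃ y : A, Tendsto
      (fun n : ℕ => (n : ℂ)⁻¹ • ∑ k ∈ Finset.range n, b k • (⇑T)^[k] x) atTop (𝓝 y) := by
  obtain ⟨L, hL⟩ := hb.exists_tendsto_average
  obtain ⟨D, hD⟩ := hb.bounded
  have hsub (k : ℕ) : (⇑T)^[k] (x - φ x • 1) = (⇑T)^[k] x - φ x • 1 := by
    rw [← CStarDynamics.toCLM_pow_apply, map_sub, map_smul, CStarDynamics.toCLM_pow_apply,
      CStarDynamics.toCLM_pow_apply, Function.iterate_fixed hT.map_one]
  have h0 := CStarDynamics.tendsto_weighted_average_zero (CStarDynamics.toCLM T)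
    (fun k a ↦ by
      rw [CStarDynamics.toCLM_pow_apply]
      exact CStarDynamics.norm_iterate_apply_le hT.map_one k a)
    (x - φ x • 1) (fun ψ ↦ (hT.mixing x ψ).congr fun n ↦ by
      simp only [CStarDynamics.toCLM_pow_apply, hsub, map_sub ψ, map_smul ψ, smul_eq_mul,
        mul_comm (ψ 1)]) hD
  refine ⟨0 + L • φ x • 1, (h0.add (hL.smul_const (φ x • (1 : A)))).congr fun n ↦ ?_⟩
  simp only [CStarDynamics.toCLM_pow_apply, hsub, smul_sub, Finset.sum_sub_distrib, mul_smul,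
    Finset.sum_smul]
  abel
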